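/- Fix a nonempty set of labels $\Sigma$. A weak transition system is a triple $X=(S,\mu:L\to\Sigma,T=\bigcup_{n\ge 1}T_n)$ where $S$ is a set of states, $L$ is a set of actions, $\mu$ is a labelling map, and $T_n\subset S\times L^n\times S$ for $n\ge 1$ is a set of $n$-transitions, such that: - (Multiset axiom) if $(\alpha,u_1,\dots,u_n,\beta)$ is a transition, then so is $(\alpha,u_{\sigma(1)},\dots,u_{\sigma(n)},\beta)$ for every permutation $\sigma$ of $\{1,\dots,n\}$; - (Patching axiom) for all $n\ge 3$ and all $p,q\ge 1$ with $p+q<n$, if $(\alpha,u_1,\dots,u_n,\beta)$, $(\alpha,u_1,\dots,u_p,\nu_1)$, $(\nu_1,u_{p+1},\dots,u_n,\beta)$, $(\alpha,u_1,\dots,u_{p+q},\nu_2)$ and $(\nu_2,u_{p+q+1},\dots,u_n,\beta)$ are transitions, then $(\nu_1,u_{p+1},\dots,u_{p+q},\nu_2)$ is a transition. A map of weak transition systems $X \to X'=(S',\mu':L'\to\Sigma,T')$ is a pair of set maps $f_0:S\to S'$ and $\widetilde f:L\to L'$ with $\mu'\widetilde f=\mu$ such that $(f_0(\alpha),\widetilde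 f(u_1),\dots,\widetilde f(u_n),f_0(\beta))$ is a transition of $X'$ whenever $(\alpha,u_1,\dots,u_n,\beta)$ is a transition of $X$. Let $\mathrm{WTS}$ be the resulting category. A set is regarded as a weak transition system having it as set of states, with no actions and no transitions. For $x\in\Sigma$, let $\underline{x}$ be the weak transition system with no states, one action, labelled by $x$, and no transitions. For $n\ge 1$ and $x_1,\dots,x_n\in\Sigma$, let $C_n[x_1,\dots,x_n]^{ext}$ be the weak transition system with two states $0_n\neq 1_n$, with the $n$ actions $(x_1,1),\dots,(x_n,n)$, where $(x_i,i)$ is labelled by $x_i$, and with the transitions $(0_n,(x_{\sigma(1)},\sigma(1)),\dots,(x_{\sigma(n)},\sigma(n)),1_n)$ for all permutations $\sigma$ of $\{1,\dots,n\}$. Let $\mathcal I$ be the set consisting of the maps $\varnothing\to\{0\}$, the maps $\varnothing\to\underline{x}$ for $x\in\Sigma$, and the inclusions $\{0_n,1_n\}\sqcup\underline{x_1}\sqcup\dots\sqcup\underline{x_n}\subset C_n[x_1,\dots,x_n]^{ext}$ for $n\ge 1$ and $x_1,\dots,x_n\in\Sigma$. Let $\mathrm{cell}(\mathcal I)$ be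 the class of maps of $\mathrm{WTS}$ that are transfinite compositions of pushouts of elements of $\mathcal I$, and let $\mathrm{cof}(\mathcal I)$ be the class of maps that have the left lifting property with respect to every map having the right lifting property with respect to all elements of $\mathcal I$. **Proposition.** In $\mathrm{WTS}$ one has $\mathrm{cell}(\mathcal I)=\mathrm{cof}(\mathcal I)$, and this class of maps is the class of monomorphisms of $\mathrm{WTS}$. -/

import Mathlib

open CategoryTheory

universe u

/-- A weak transition system over the set of labels `Lab`. The tuple
`(α, u₁, …, uₙ, β)` is encoded by the two states `α`, `β` and the list `[u₁, …, uₙ]`;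
`Tr α [u₁, …, uₙ] β` says that this tuple is an `n`-transition. -/
structure WTS (Lab : Type u) : Type (u + 1) where
  /-- the set of states -/
  State : Type u
  /-- the set of actions -/
  Action : Type u
  /-- the labelling map -/
  label : Action → Lab
  /-- the transitions -/
  Tr : State → List Action → State → Prop
  /-- there are `n`-transitions only for `n ≥ 1` -/
  ne_nil : ∀ {α : State} {l : List Action} {β : State}, Tr α l β → l ≠ []
  /-- Multiset axiom -/
  multiset : ∀ {α : State} {l l' : List Action} {β : State},
    l.Perm l' → Tr α l β → Tr α l' β
  /-- Patching axiom; here `a = [u₁, …, u_p]`, `b = [u_{p+1}, …, u_{p+q}]` and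
  `c = [u_{p+q+1}, …, uₙ]` with `p, q ≥ 1` and `p + q < n`. -/
  patching : ∀ {α ν₁ ν₂ β : State} {a b c : List Action}, a ≠ [] → b ≠ [] → c ≠ [] →
    Tr α (a ++ b ++ c) β →
    Tr α a ν₁ → Tr ν₁ (b ++ c) β →
    Tr α (a ++ b) ν₂ → Tr ν₂ c β →
    Tr ν₁ b ν₂

namespace WTS

/-- A map of weak transition systems. -/
@[ext]
structure Hom {Lab : Type u} (X Y : WTS Lab) : Type u where
  /-- the map on states -/
  onState : X.State → Y.State
  /-- the map on actions -/
  onAction : X.Action → Y.Action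
  label_onAction : ∀ a, Y.label (onAction a) = X.label a
  map_Tr : ∀ {α l β}, X.Tr α l β → Y.Tr (onState α) (l.map onAction) (onState β)

instance (Lab : Type u) : Category.{u} (WTS Lab) where
  Hom X Y := Hom X Y
  id X := ⟨id, id, fun _ => rfl, fun h => by simpa using h⟩
  comp f g := ⟨g.onState ∘ f.onState, g.onAction ∘ f.onAction,
    fun a => (g.label_onAction _).trans (f.label_onAction a),
    fun h => by simpa using g.map_Tr (f.map_Tr h)⟩

/-- The weak transition system with states `S`, with actions `A` labelled by `lab`, and
without any transition. -/
def discrete {Lab : Type u} (S A : Type u) (lab : A → Lab) : WTS Lab where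
  State := S
  Action := A
  label := lab
  Tr _ _ _ := False
  ne_nil h := h.elim
  multiset _ h := h
  patching _ _ _ h := h.elim

/-- A set, seen as a weak transition system without actions and transitions. -/
def ofSet (Lab : Type u) (S : Type u) : WTS Lab :=
  discrete S PEmpty PEmpty.elim

/-- The empty weak transition system `∅`. -/
def empty (Lab : Type u) : WTS Lab := ofSet Lab PEmpty

/-- The weak transition system `{0}`. -/
def point (Lab : Type u) : WTS Lab := ofSet Lab PUnit

/-- The weak transition system `x̲`: no state, one action, labelled by `x`. -/
def single {Lab : Type u} (x : Lab) : WTS Lab :=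
  discrete PEmpty PUnit (fun _ => x)

/-- The map `∅ → X`. -/
def fromEmpty {Lab : Type u} (X : WTS Lab) : empty Lab ⟶ X :=
  Hom.mk (X := empty Lab) (Y := X) PEmpty.elim PEmpty.elim (fun a => a.elim) (fun h => h.elim)

/-- The pure `n`-transition `C_n[x₁, …, xₙ]^ext` for `n ≥ 1`. The two states are
`0ₙ = false` and `1ₙ = true` (they are distinct since `n ≥ 1`), and the action `(xᵢ, i)` is
represented by the index `i`. -/
def pureTransition {Lab : Type u} (n : ℕ) (hn : 1 ≤ n) (x : Fin n → Lab) : WTS Lab where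
  State := ULift Bool
  Action := ULift (Fin n)
  label i := x i.down
  Tr α l β := α = ⟨false⟩ ∧ β = ⟨true⟩ ∧
    ∃ σ : Equiv.Perm (Fin n), l = List.ofFn (fun i => ULift.up (σ i))
  ne_nil := by
    rintro α l β ⟨-, -, σ, rfl⟩ h
    have := congrArg List.length h
    simp at this
    omega
  multiset := by
    rintro α l l' β hl ⟨hα, hβ, σ, rfl⟩
    refine ⟨hα, hβ, ?_⟩
    have hlen : l'.length = n := by simpa using hl.length_eq.symm
    have hnd : l'.Nodup := hl.nodup_iff.1
      (List.nodup_ofFn.2 (ULift.up_injective.comp σ.injective))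
    have hinj : Function.Injective (fun i : Fin n => (l'.get (i.cast hlen.symm)).down) :=
      fun i j h => by
        simpa using hnd.injective_get (ULift.down_injective h)
    refine ⟨Equiv.ofBijective _ (Finite.injective_iff_bijective.1 hinj), ?_⟩
    apply List.ext_get
    · simp [hlen]
    · intro i h₁ h₂
      simp
  patching := by
    rintro α ν₁ ν₂ β a b c - hb - ⟨-, -, σ, h⟩ ⟨-, -, τ, h'⟩
    have h₁ := congrArg List.length h
    have h₂ := congrArg List.length h'
    have h₃ := List.length_pos_iff.2 hb
    simp at h₁ h₂
    omega

/-- The weak transition system `{0ₙ, 1ₙ} ⊔ x̲₁ ⊔ … ⊔ x̲ₙ`: the states and the actions of the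
pure `n`-transition, and no transition. -/
def pureBoundary {Lab : Type u} (n : ℕ) (x : Fin n → Lab) : WTS Lab :=
  discrete (ULift Bool) (ULift (Fin n)) (fun i => x i.down)

/-- The inclusion `{0ₙ, 1ₙ} ⊔ x̲₁ ⊔ … ⊔ x̲ₙ ⊂ C_n[x₁, …, xₙ]^ext`. -/
def boundaryInclusion {Lab : Type u} (n : ℕ) (hn : 1 ≤ n) (x : Fin n → Lab) :
    pureBoundary n x ⟶ pureTransition n hn x :=
  Hom.mk (X := pureBoundary n x) (Y := pureTransition n hn x)
    id id (fun _ => rfl) (fun h => h.elim)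

/-- The set of maps `𝓘`. -/
inductive generating (Lab : Type u) : MorphismProperty (WTS Lab)
  | point : generating Lab (fromEmpty (point Lab))
  | single (x : Lab) : generating Lab (fromEmpty (single x))
  | boundary (n : ℕ) (hn : 1 ≤ n) (x : Fin n → Lab) :
      generating Lab (boundaryInclusion n hn x)

end WTS

/-- `cell(W)`: the transfinite compositions of pushouts of elements of `W`. -/
def cell {C : Type (u + 1)} [LargeCategory.{u} C] (W : MorphismProperty C) :
    MorphismProperty C :=
  MorphismProperty.transfiniteCompositions.{u} W.pushouts

/-- `cof(W)`: the maps with the left lifting property with respect to all maps that have the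
right lifting property with respect to `W`. -/
def cof {C : Type (u + 1)} [LargeCategory.{u} C] (W : MorphismProperty C) :
    MorphismProperty C :=
  W.rlp.llp

/-! The inclusion of `cell` in `cof` is formal: transfinite compositions and pushouts preserve left
lifting properties. Two inclusions remain. Maps in `cof` are monic (`cof_le_monomorphisms`). An
indiscrete system with a state and with every label present lifts against all generators over the
terminal object. `X` embeds in such a system, and extending this embedding along `f` forces `f` to
be injective on states and actions, hence monic. Monomorphisms are cellular
(`monomorphisms_le_cell`). Starting from `X`, attach the missing states, the missing actions, then
every transition of `Y`, along a well-order. A stage is the system freely generated by the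
transitions of `X` and those attached so far. Adding a cell is a pushout of a generator, even if its
transition already follows from the axioms, and limit stages are colimits. Injectivity identifies
the initial stage with `X`; the final one is `Y`. -/

namespace WTS

variable {Lab : Type u}

/-! ### Morphisms, and monomorphisms as injective pairs of maps. -/

section Basic

variable {X Y Z : WTS Lab}

/-- The action of a morphism on states. -/
def st (f : X ⟶ Y) : X.State → Y.State := Hom.onState f

/-- The action of a morphism on actions. -/
def ac (f : X ⟶ Y) : X.Action → Y.Action := Hom.onAction f

/-- The constructor of morphisms of weak transition systems. -/
def mkHom (s : X.State → Y.State) (a : X.Action → Y.Action)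
    (h : ∀ u, Y.label (a u) = X.label u)
    (ht : ∀ {α l β}, X.Tr α l β → Y.Tr (s α) (l.map a) (s β)) : X ⟶ Y :=
  Hom.mk s a h ht

@[simp] lemma st_comp (f : X ⟶ Y) (g : Y ⟶ Z) : st (f ≫ g) = st g ∘ st f := rfl

@[simp] lemma ac_comp (f : X ⟶ Y) (g : Y ⟶ Z) : ac (f ≫ g) = ac g ∘ ac f := rfl

@[simp] lemma label_ac (f : X ⟶ Y) (u : X.Action) : Y.label (ac f u) = X.label u :=
  Hom.label_onAction f u

lemma tr_map (f : X ⟶ Y) {α l β} (h : X.Tr α l β) :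
    Y.Tr (st f α) (l.map (ac f)) (st f β) :=
  Hom.map_Tr f h

lemma tr_map_map (f : X ⟶ Y) {A : Type*} {g : A → X.Action} {α : X.State} {l : List A}
    {β : X.State} (h : X.Tr α (l.map g) β) :
    Y.Tr (st f α) (l.map (fun a => ac f (g a))) (st f β) := by
  have := tr_map f h
  rwa [List.map_map] at this

lemma hom_ext {f g : X ⟶ Y} (hs : ∀ s, st f s = st g s) (ha : ∀ a, ac f a = ac g a) :
    f = g :=
  Hom.ext (funext hs) (funext ha)

lemma empty_hom_ext (f g : empty Lab ⟶ X) : f = g :=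
  hom_ext (fun s => PEmpty.elim s) (fun a => PEmpty.elim a)

/-- The map `{0} ⟶ X` given by a state. -/
def pointHom (s : X.State) : point Lab ⟶ X :=
  mkHom (X := point Lab) (fun _ => s) (fun a => PEmpty.elim a) (fun a => PEmpty.elim a)
    (fun h => h.elim)

/-- The map `x̲ ⟶ X` given by an action. -/
def singleHom (a : X.Action) (x : Lab) (h : X.label a = x) : single x ⟶ X :=
  mkHom (X := single x) (fun s => PEmpty.elim s) (fun _ => a) (fun _ => h)
    (fun h => h.elim)

lemma point_hom_ext {f g : point Lab ⟶ X} (h : st f PUnit.unit = st g PUnit.unit) : f = g :=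
  hom_ext (fun _ => h) (fun a => PEmpty.elim a)

lemma single_hom_ext {x : Lab} {f g : single x ⟶ X}
    (h : ac f PUnit.unit = ac g PUnit.unit) : f = g :=
  hom_ext (fun s => PEmpty.elim s) (fun _ => h)

lemma mono_of_injective (f : X ⟶ Y) (hs : Function.Injective (st f))
    (ha : Function.Injective (ac f)) : Mono f where
  right_cancellation _ _ e := hom_ext
    (fun s => hs (congrFun (congrArg st e) s)) (fun a => ha (congrFun (congrArg ac e) a))

/-- States are represented by `{0}`; below, actions labelled by `x` are represented by `x̲`. -/
lemma st_injective_of_mono (f : X ⟶ Y) [Mono f] : Function.Injective (st f) := by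
  intro s s' h
  have : pointHom s = pointHom s' := by
    rw [← cancel_mono f]
    exact point_hom_ext h
  exact congrFun (congrArg st this) PUnit.unit

lemma ac_injective_of_mono (f : X ⟶ Y) [Mono f] : Function.Injective (ac f) := by
  intro a a' h
  have hl : X.label a = X.label a' := by rw [← label_ac f, h, label_ac]
  have : singleHom a _ hl = singleHom a' _ rfl := by
    rw [← cancel_mono f]
    exact single_hom_ext h
  exact congrFun (congrArg ac this) PUnit.unit

end Basic

/-! ### Maps in `cof` are monomorphisms. -/

section Indiscrete

/-- The weak transition system in which every tuple `(α, u₁, …, uₙ, β)` with `n ≥ 1` is a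
transition. -/
def indiscrete (S A : Type u) (lab : A → Lab) : WTS Lab where
  State := S
  Action := A
  label := lab
  Tr _ l _ := l ≠ []
  ne_nil h := h
  multiset h h' := by
    rintro rfl
    exact h' h.eq_nil
  patching _ hb _ _ _ _ _ _ := hb

/-- A pair of maps compatible with the labels is a morphism to an indiscrete system. -/
def toIndiscrete {X : WTS Lab} {S A : Type u} {lab : A → Lab} (s : X.State → S)
    (a : X.Action → A) (h : ∀ u, lab (a u) = X.label u) : X ⟶ indiscrete S A lab :=
  mkHom (Y := indiscrete S A lab) s a h
    (fun h => by simpa [indiscrete] using X.ne_nil h)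

/-- The target is terminal: its actions are determined by their labels. -/
lemma toTerminal_ext {X : WTS Lab} (f g : X ⟶ indiscrete PUnit Lab id) : f = g :=
  hom_ext (fun _ => rfl) (fun a => (label_ac f a).trans (label_ac g a).symm)

lemma rlp_indiscrete {S A : Type u} [Nonempty S] (lab : A → Lab)
    (hlab : Function.Surjective lab)
    (p : indiscrete S A lab ⟶ indiscrete PUnit Lab id) :
    (generating Lab).rlp p := by
  intro _ _ i hi
  refine ⟨fun {f g} sq => ?_⟩
  cases hi with
  | point =>
    exact CommSq.HasLift.mk' ⟨pointHom (X := indiscrete S A lab) (Classical.arbitrary S),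
      empty_hom_ext _ _, toTerminal_ext _ _⟩
  | single x =>
    obtain ⟨a, ha⟩ := hlab x
    exact CommSq.HasLift.mk' ⟨singleHom (X := indiscrete S A lab) a x ha,
      empty_hom_ext _ _, toTerminal_ext _ _⟩
  | boundary n hn x =>
    exact CommSq.HasLift.mk' ⟨toIndiscrete (X := pureTransition n hn x) (st f) (ac f)
      (fun u => label_ac f u), rfl, toTerminal_ext _ _⟩

lemma cof_le_monomorphisms :
    cof (generating Lab) ≤ MorphismProperty.monomorphisms (WTS Lab) := by
  intro X Y f hf
  -- The summand `Lab` makes the labelling surjective, and `Option` makes the set of states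
  -- nonempty, as lifting requires even when `X` is empty.
  let lab : X.Action ⊕ Lab → Lab := Sum.elim X.label id
  let p : indiscrete (Option X.State) (X.Action ⊕ Lab) lab ⟶ indiscrete PUnit Lab id :=
    toIndiscrete (fun _ => PUnit.unit) lab (fun _ => rfl)
  let i : X ⟶ indiscrete (Option X.State) (X.Action ⊕ Lab) lab :=
    toIndiscrete some Sum.inl (fun _ => rfl)
  have := hf p (rlp_indiscrete lab (fun x => ⟨Sum.inr x, rfl⟩) p)
  have sq : CommSq i f p (toIndiscrete (fun _ => PUnit.unit) Y.label (fun _ => rfl)) :=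
    ⟨toTerminal_ext _ _⟩
  have fac : f ≫ sq.lift = i := sq.fac_left
  refine mono_of_injective f (Function.Injective.of_comp (f := st sq.lift) ?_)
    (Function.Injective.of_comp (f := ac sq.lift) ?_)
  · rw [← st_comp, fac]
    exact Option.some_injective _
  · rw [← ac_comp, fac]
    exact Sum.inl_injective

end Indiscrete

/-! ### Systems freely generated by tuples. -/

section Generate

/-- The closure of a set of tuples under the multiset and patching axioms. -/
inductive Gen {S A : Type u} (G : S → List A → S → Prop) : S → List A → S → Prop
  | of {α l β} (h : G α l β) : Gen G α l β
  | perm {α l l' β} (h : l.Perm l') (h' : Gen G α l β) : Gen G α l' β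
  | patch {α ν₁ ν₂ β a b c} (ha : a ≠ []) (hb : b ≠ []) (hc : c ≠ [])
      (h₁ : Gen G α (a ++ b ++ c) β) (h₂ : Gen G α a ν₁) (h₃ : Gen G ν₁ (b ++ c) β)
      (h₄ : Gen G α (a ++ b) ν₂) (h₅ : Gen G ν₂ c β) : Gen G ν₁ b ν₂

/-- The weak transition system freely generated by a set of tuples. -/
def generate (S A : Type u) (lab : A → Lab) (G : S → List A → S → Prop)
    (hG : ∀ {α l β}, G α l β → l ≠ []) : WTS Lab where
  State := S
  Action := A
  label := lab
  Tr := Gen G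
  ne_nil h := by
    induction h with
    | of h => exact hG h
    | perm h _ ih =>
      rintro rfl
      exact ih h.eq_nil
    | patch _ hb => exact hb
  multiset := Gen.perm
  patching := Gen.patch

/-- Freeness: the target satisfies both axioms, so only generators need checking. -/
lemma Gen.map {S A : Type u} {G : S → List A → S → Prop} {Z : WTS Lab} (s : S → Z.State)
    (a : A → Z.Action) (h : ∀ {α l β}, G α l β → Z.Tr (s α) (l.map a) (s β))
    {α l β} (hl : Gen G α l β) : Z.Tr (s α) (l.map a) (s β) := by
  induction hl with
  | of hl => exact h hl
  | perm hp _ ih => exact Z.multiset (hp.map a) ih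
  | patch ha hb hc _ _ _ _ _ h₁ h₂ h₃ h₄ h₅ =>
    simp only [List.map_append] at h₁ h₃ h₄
    exact Z.patching (by simpa using ha) (by simpa using hb) (by simpa using hc) h₁ h₂ h₃ h₄ h₅

end Generate

/-! ### The intermediate systems between `X` and `Y`. -/

section Stage

variable {X Y : WTS Lab} (f : X ⟶ Y)

/-- The cells to be attached to `X` in order to obtain `Y`: the states and the actions which
are not in the image, and all the transitions. -/
abbrev Cell : Type u :=
  ({s : Y.State // s ∉ Set.range (st f)} ⊕ {a : Y.Action // a ∉ Set.range (ac f)}) ⊕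
    {t : Y.State × List Y.Action × Y.State // Y.Tr t.1 t.2.1 t.2.2}

variable (D D' : Set (Cell f))

/-- The states of `X` and of the cells in `D`. -/
abbrev StageState : Type u := {s : Y.State // ∀ h, Sum.inl (Sum.inl ⟨s, h⟩) ∈ D}

/-- The actions of `X` and of the cells in `D`. -/
abbrev StageAction : Type u := {a : Y.Action // ∀ h, Sum.inl (Sum.inr ⟨a, h⟩) ∈ D}

/-- The transitions of `X` and of the cells in `D`. -/
def StageGen (α : Y.State) (l : List Y.Action) (β : Y.State) : Prop :=
  (∃ α' l' β', X.Tr α' l' β' ∧ st f α' = α ∧ l'.map (ac f) = l ∧ st f β' = β) ∨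
    ∃ h : Y.Tr α l β, Sum.inr ⟨(α, l, β), h⟩ ∈ D

variable {f D D'}

lemma StageGen.tr {α l β} (h : StageGen f D α l β) : Y.Tr α l β := by
  obtain ⟨α', l', β', h, rfl, rfl, rfl⟩ | ⟨h, -⟩ := h
  · exact tr_map f h
  · exact h

lemma StageGen.mono (hD : D ⊆ D') {α l β} (h : StageGen f D α l β) : StageGen f D' α l β :=
  h.imp id (fun ⟨h, h'⟩ => ⟨h, hD h'⟩)

variable (f D) in
/-- The weak transition system obtained from `X` by attaching the cells in `D`. -/
def stage : WTS Lab :=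
  generate (StageState f D) (StageAction f D) (fun a => Y.label a.1)
    (fun α l β => StageGen f D α.1 (l.map Subtype.val) β.1)
    (fun h h' => Y.ne_nil h.tr (by rw [h', List.map_nil]))

/-- Constructor for morphisms from a stage. -/
def stageHom {Z : WTS Lab} (s : StageState f D → Z.State) (a : StageAction f D → Z.Action)
    (hl : ∀ u, Z.label (a u) = Y.label u.1)
    (h : ∀ {α : StageState f D} {l : List (StageAction f D)} {β : StageState f D},
      StageGen f D α.1 (l.map Subtype.val) β.1 → Z.Tr (s α) (l.map a) (s β)) :
    stage f D ⟶ Z :=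
  mkHom (X := stage f D) s a hl (Gen.map s a h)

lemma stage_tr {α : StageState f D} {l : List (StageAction f D)} {β : StageState f D}
    {m : List Y.Action} (hm : l.map Subtype.val = m) (h : StageGen f D α.1 m β.1) :
    (stage f D).Tr α l β := by
  subst hm
  exact Gen.of h

/-- The inclusion of states. -/
def StageState.incl (hD : D ⊆ D') (s : StageState f D) : StageState f D' :=
  ⟨s.1, fun h => hD (s.2 h)⟩

/-- The inclusion of actions. -/
def StageAction.incl (hD : D ⊆ D') (a : StageAction f D) : StageAction f D' :=
  ⟨a.1, fun h => hD (a.2 h)⟩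

lemma StageAction.map_val_incl (hD : D ⊆ D') (l : List (StageAction f D)) :
    (l.map (StageAction.incl hD)).map Subtype.val = l.map Subtype.val := by
  rw [List.map_map]
  rfl

/-- The inclusion of stages. -/
def stageMap (hD : D ⊆ D') : stage f D ⟶ stage f D' :=
  stageHom (Z := stage f D') (StageState.incl hD) (StageAction.incl hD) (fun _ => rfl)
    (fun h => stage_tr (StageAction.map_val_incl hD _) (h.mono hD))

variable (f) in
/-- The stages form a functor. -/
def stageFunctor : Set (Cell f) ⥤ WTS Lab where
  obj D := stage f D
  map φ := stageMap (leOfHom φ)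
  map_id _ := rfl
  map_comp _ _ := rfl

variable (f D) in
/-- The map from `X` to a stage. -/
def toStage : X ⟶ stage f D :=
  mkHom (Y := stage f D) (fun s => (⟨st f s, fun h => (h ⟨s, rfl⟩).elim⟩ : StageState f D))
    (fun a => (⟨ac f a, fun h => (h ⟨a, rfl⟩).elim⟩ : StageAction f D)) (fun a => label_ac f a)
    (fun {α l β} h => stage_tr List.map_map (Or.inl ⟨α, l, β, h, rfl, rfl, rfl⟩))

variable (f D) in
/-- The map from a stage to `Y`. -/
def fromStage : stage f D ⟶ Y :=
  stageHom Subtype.val Subtype.val (fun _ => rfl) (fun h => h.tr)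

/-- With all cells attached, every transition of `Y` is a generator. -/
lemma isIso_fromStage_univ : IsIso (fromStage f Set.univ) :=
  ⟨mkHom (Y := stage f Set.univ) (fun s => (⟨s, fun _ => trivial⟩ : StageState f Set.univ))
    (fun a => (⟨a, fun _ => trivial⟩ : StageAction f Set.univ)) (fun _ => rfl)
    (fun {_ l _} h => stage_tr (List.map_map.trans (List.map_id l)) (Or.inr ⟨h, trivial⟩)), rfl, rfl⟩

lemma isIso_toStage_empty (hs : Function.Injective (st f)) (ha : Function.Injective (ac f)) :
    IsIso (toStage f ∅) := by
  have es (s : StageState f ∅) : ∃ x, st f x = s.1 := by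
    by_contra h
    exact s.2 h
  have ea (a : StageAction f ∅) : ∃ x, ac f x = a.1 := by
    by_contra h
    exact a.2 h
  choose is his using es
  choose ia hia using ea
  refine ⟨stageHom is ia (fun u => by rw [← label_ac f, hia]) ?_, ?_, ?_⟩
  · rintro α l β (⟨α', l', β', h, h₁, h₂, h₃⟩ | ⟨_, h⟩)
    · have e₁ : is α = α' := hs ((his _).trans h₁.symm)
      have e₃ : is β = β' := hs ((his _).trans h₃.symm)
      -- Injectivity recovers the original transition of `X` from its image.
      have e₂ : l.map ia = l' := by
        apply List.map_injective_iff.2 ha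
        rw [h₂, List.map_map]
        exact List.map_congr_left (fun a _ => hia a)
      rwa [e₁, e₂, e₃]
    · exact h.elim
  · exact hom_ext (fun s => hs (his _)) (fun a => ha (hia _))
  · exact hom_ext (fun s => Subtype.ext (his s)) (fun a => Subtype.ext (hia a))

/-- Constructor for morphisms from a stage which extend a given morphism from `X`. -/
def stageDesc {Z : WTS Lab} (g : X ⟶ Z) (s : StageState f D → Z.State)
    (a : StageAction f D → Z.Action) (hl : ∀ u, Z.label (a u) = Y.label u.1)
    (hs : ∀ x, s (st (toStage f D) x) = st g x) (ha : ∀ u, a (ac (toStage f D) u) = ac g u)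
    (h : ∀ (α : StageState f D) (l : List (StageAction f D)) (β : StageState f D)
      (ht : Y.Tr α.1 (l.map Subtype.val) β.1), Sum.inr ⟨(_, _, _), ht⟩ ∈ D →
        Z.Tr (s α) (l.map a) (s β)) :
    stage f D ⟶ Z :=
  stageHom s a hl (by
    rintro α l β (⟨α', l', β', h', h₁, h₂, h₃⟩ | ⟨h₁, h₂⟩)
    · have e₁ : st (toStage f D) α' = α := Subtype.ext h₁
      have e₃ : st (toStage f D) β' = β := Subtype.ext h₃
      have e₂ : l'.map (ac (toStage f D)) = l :=
        List.map_injective_iff.2 Subtype.val_injective (List.map_map.trans h₂)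
      have e₄ : l.map a = l'.map (ac g) := by
        rw [← e₂]
        exact List.map_map.trans (List.map_congr_left (fun u _ => ha u))
      rw [e₄, ← e₁, ← e₃, hs, hs]
      exact tr_map g h'
    · exact h _ _ _ h₁ h₂)

end Stage

/-! ### Attaching one cell is a pushout of a generator. -/

section Pushout

open Limits

variable {X Y : WTS Lab} {f : X ⟶ Y} {D D' : Set (Cell f)}

lemma isPushout_of_exists {C : Type*} [Category* C] {A B P Q : C} {f : A ⟶ P} {g : A ⟶ B}
    {i : P ⟶ Q} {j : B ⟶ Q} (w : f ≫ i = g ≫ j)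
    (ex : ∀ {Z : C} (φ : P ⟶ Z) (ψ : B ⟶ Z), f ≫ φ = g ≫ ψ →
      ∃ d : Q ⟶ Z, i ≫ d = φ ∧ j ≫ d = ψ)
    (uniq : ∀ {Z : C} (d d' : Q ⟶ Z), i ≫ d = i ≫ d' → j ≫ d = j ≫ d' → d = d') :
    IsPushout f g i j := by
  refine ⟨⟨w⟩, ⟨PushoutCocone.IsColimit.mk w
    (fun c => (ex c.inl c.inr c.condition).choose)
    (fun c => (ex c.inl c.inr c.condition).choose_spec.1)
    (fun c => (ex c.inl c.inr c.condition).choose_spec.2)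
    (fun c m h₁ h₂ => uniq _ _ ?_ ?_)⟩⟩
  · rw [h₁, (ex c.inl c.inr c.condition).choose_spec.1]
  · rw [h₂, (ex c.inl c.inr c.condition).choose_spec.2]

open Classical in
lemma pushouts_stageMap_state (hD : D ⊆ D') (s₀ : Y.State) (h₀ : s₀ ∉ Set.range (st f))
    (hD' : ∀ c, c ∈ D' ↔ c = Sum.inl (Sum.inl ⟨s₀, h₀⟩) ∨ c ∈ D)
    (hs₀ : Sum.inl (Sum.inl ⟨s₀, h₀⟩) ∉ D) (hc : ∀ t, Sum.inr t ∈ D → ∀ c, Sum.inl c ∈ D) :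
    (generating Lab).pushouts (stageMap hD) := by
  have ha (a : StageAction f D') (h) : Sum.inl (Sum.inr ⟨a.1, h⟩) ∈ D := by
    simpa using (hD' _).1 (a.2 h)
  have hs (s : StageState f D') (h : ¬ ∀ h, Sum.inl (Sum.inl ⟨s.1, h⟩) ∈ D) : s.1 = s₀ := by
    obtain ⟨h', h''⟩ := not_forall.1 h
    simpa [h''] using (hD' _).1 (s.2 h')
  let p : StageState f D' := ⟨s₀, fun h => (hD' _).2 (Or.inl rfl)⟩
  refine MorphismProperty.pushouts_mk _ (f := fromEmpty _) (q := fromEmpty (point Lab))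
    (g := pointHom (X := stage f D') p) (isPushout_of_exists (empty_hom_ext _ _) ?_ ?_) .point
  · intro Z φ ψ _
    refine ⟨stageDesc (toStage f D ≫ φ) (fun s => if h : ∀ h, Sum.inl (Sum.inl ⟨s.1, h⟩) ∈ D
      then st φ (⟨s.1, h⟩ : StageState f D) else st ψ PUnit.unit)
      (fun a => ac φ (⟨a.1, ha a⟩ : StageAction f D)) (fun a => label_ac φ _)
      (fun x => dif_pos _) (fun a => rfl) ?_, ?_, ?_⟩
    · intro α l β ht h
      -- No transition cell is present yet: by `hc` it would require `s₀` to be attached already.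
      exact absurd (hc _ (by simpa using (hD' _).1 h) _) hs₀
    · exact hom_ext (fun s => dif_pos s.2) (fun _ => rfl)
    · exact point_hom_ext (dif_neg (fun h => hs₀ (h _)))
  · intro Z d d' h₁ h₂
    refine hom_ext (fun s => ?_) (fun a => ?_)
    · by_cases h : ∀ h, Sum.inl (Sum.inl ⟨Subtype.val s, h⟩) ∈ D
      · exact congrFun (congrArg st h₁) (⟨s.1, h⟩ : StageState f D)
      · obtain rfl : s = p := Subtype.ext (hs s h)
        exact congrFun (congrArg st h₂) PUnit.unit
    · exact congrFun (congrArg ac h₁) (⟨a.1, ha a⟩ : StageAction f D)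

open Classical in
lemma pushouts_stageMap_action (hD : D ⊆ D') (a₀ : Y.Action) (h₀ : a₀ ∉ Set.range (ac f))
    (hD' : ∀ c, c ∈ D' ↔ c = Sum.inl (Sum.inr ⟨a₀, h₀⟩) ∨ c ∈ D)
    (ha₀ : Sum.inl (Sum.inr ⟨a₀, h₀⟩) ∉ D) (hc : ∀ t, Sum.inr t ∈ D → ∀ c, Sum.inl c ∈ D) :
    (generating Lab).pushouts (stageMap hD) := by
  have hs (s : StageState f D') (h) : Sum.inl (Sum.inl ⟨s.1, h⟩) ∈ D := by
    simpa using (hD' _).1 (s.2 h)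
  have ha (a : StageAction f D') (h : ¬ ∀ h, Sum.inl (Sum.inr ⟨a.1, h⟩) ∈ D) : a.1 = a₀ := by
    obtain ⟨h', h''⟩ := not_forall.1 h
    simpa [h''] using (hD' _).1 (a.2 h')
  let p : StageAction f D' := ⟨a₀, fun h => (hD' _).2 (Or.inl rfl)⟩
  refine MorphismProperty.pushouts_mk _ (f := fromEmpty _)
    (q := fromEmpty (single (Y.label a₀))) (g := singleHom (X := stage f D') p _ rfl)
    (isPushout_of_exists (empty_hom_ext _ _) ?_ ?_) (.single _)
  · intro Z φ ψ _
    refine ⟨stageDesc (toStage f D ≫ φ) (fun s => st φ (⟨s.1, hs s⟩ : StageState f D))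
      (fun a => if h : ∀ h, Sum.inl (Sum.inr ⟨a.1, h⟩) ∈ D
      then ac φ (⟨a.1, h⟩ : StageAction f D) else ac ψ PUnit.unit)
      (fun a => ?_) (fun s => rfl) (fun x => dif_pos _) ?_, ?_, ?_⟩
    · split_ifs with h
      · exact label_ac φ _
      · rw [ha a h]
        exact label_ac ψ _
    · intro α l β ht h
      exact absurd (hc _ (by simpa using (hD' _).1 h) _) ha₀
    · exact hom_ext (fun _ => rfl) (fun a => dif_pos a.2)
    · exact single_hom_ext (dif_neg (fun h => ha₀ (h _)))
  · intro Z d d' h₁ h₂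
    refine hom_ext (fun s => ?_) (fun a => ?_)
    · exact congrFun (congrArg st h₁) (⟨s.1, hs s⟩ : StageState f D)
    · by_cases h : ∀ h, Sum.inl (Sum.inr ⟨Subtype.val a, h⟩) ∈ D
      · exact congrFun (congrArg ac h₁) (⟨a.1, h⟩ : StageAction f D)
      · obtain rfl : a = p := Subtype.ext (ha a h)
        exact congrFun (congrArg ac h₂) PUnit.unit

/-- All states and actions are already present, so only the generating tuples change, and a map out
of the new stage is determined by its restriction to the old one. -/
lemma pushouts_stageMap_transition (hD : D ⊆ D') (α₀ : Y.State) (l₀ : List Y.Action)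
    (β₀ : Y.State) (h₀ : Y.Tr α₀ l₀ β₀)
    (hD' : ∀ c, c ∈ D' ↔ c = Sum.inr ⟨(α₀, l₀, β₀), h₀⟩ ∨ c ∈ D)
    (hc : ∀ c, Sum.inl c ∈ D) :
    (generating Lab).pushouts (stageMap hD) := by
  have hn : 1 ≤ l₀.length := List.length_pos_iff.2 (Y.ne_nil h₀)
  let s (E : Set (Cell f)) (hE : D ⊆ E) (x : Y.State) : StageState f E :=
    ⟨x, fun _ => hE (hc _)⟩
  let a (E : Set (Cell f)) (hE : D ⊆ E) (u : Y.Action) : StageAction f E :=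
    ⟨u, fun _ => hE (hc _)⟩
  let x (i : Fin l₀.length) : Lab := Y.label (l₀.get i)
  let v (b : ULift.{u} Bool) : Y.State := if b.down then β₀ else α₀
  let w (i : ULift.{u} (Fin l₀.length)) : Y.Action := l₀.get i.down
  have ofFn_w (σ : Equiv.Perm (Fin l₀.length)) :
      (List.ofFn (fun i => ULift.up (σ i))).map w = List.ofFn (l₀.get ∘ σ) := by
    rw [List.map_ofFn]
    rfl
  let i : pureBoundary _ x ⟶ stage f D :=
    mkHom (X := pureBoundary _ x) (Y := stage f D) (s D subset_rfl ∘ v) (a D subset_rfl ∘ w)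
      (fun _ => rfl) (fun h => h.elim)
  let j : pureTransition _ hn x ⟶ stage f D' :=
    mkHom (X := pureTransition _ hn x) (Y := stage f D') (s D' hD ∘ v) (a D' hD ∘ w)
      (fun _ => rfl) (by
        rintro α l β ⟨rfl, rfl, σ, rfl⟩
        have h : (stage f D').Tr (s D' hD α₀) (l₀.map (a D' hD)) (s D' hD β₀) :=
          stage_tr (List.map_map.trans (List.map_id l₀))
            (Or.inr ⟨h₀, (hD' _).2 (Or.inl rfl)⟩)
        -- The new cell supplies only the ordering `l₀`; the multiset axiom gives the others.
        refine (stage f D').multiset ?_ h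
        have e : (List.ofFn (fun i => ULift.up (σ i))).map (a D' hD ∘ w) =
            (List.ofFn (l₀.get ∘ σ)).map (a D' hD) := by
          rw [← ofFn_w, List.map_map]
        refine List.Perm.trans (List.Perm.map _ ?_) (.of_eq e.symm)
        have := (Equiv.Perm.ofFn_comp_perm σ l₀.get).symm
        rwa [List.ofFn_get] at this)
  refine MorphismProperty.pushouts_mk _ (f := i) (g := j)
    (isPushout_of_exists rfl ?_ ?_) (.boundary _ hn x)
  · intro Z φ ψ e
    have es (b) : st φ (s D subset_rfl (v b)) = st ψ b := congrFun (congrArg st e) b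
    have ea (b) : ac φ (a D subset_rfl (w b)) = ac ψ b := congrFun (congrArg ac e) b
    refine ⟨stageDesc (toStage f D ≫ φ) (fun y => st φ (s D subset_rfl y.1))
      (fun y => ac φ (a D subset_rfl y.1)) (fun y => label_ac φ _) (fun _ => rfl)
      (fun _ => rfl) ?_, ?_, ?_⟩
    · intro α l β ht h
      obtain h | h := (hD' _).1 h
      · have h' : (α.1, l.map Subtype.val, β.1) = (α₀, l₀, β₀) := by
          simpa using h
        simp only [Prod.mk.injEq] at h'
        obtain ⟨hα, hl, hβ⟩ := h'
        have H : Z.Tr (st ψ ⟨false⟩) ((List.ofFn ULift.up).map (ac ψ)) (st ψ ⟨true⟩) :=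
          tr_map ψ ⟨rfl, rfl, 1, rfl⟩
        have e₁ : (List.ofFn ULift.up).map (ac ψ) =
            l.map (fun y => ac φ (a D subset_rfl y.1)) := by
          have e₂ : (List.ofFn ULift.up).map w = l₀ :=
            (ofFn_w 1).trans (List.ofFn_get l₀)
          calc _ = (List.ofFn ULift.up).map (fun b => ac φ (a D subset_rfl (w b))) :=
                List.map_congr_left (fun b _ => (ea b).symm)
            _ = ((List.ofFn ULift.up).map w).map (fun u => ac φ (a D subset_rfl u)) :=
                by rw [List.map_map]; rfl
            _ = (l.map Subtype.val).map (fun u => ac φ (a D subset_rfl u)) := by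
                rw [e₂, hl]
            _ = _ := List.map_map
        rw [e₁, ← es, ← es] at H
        rw [hα, hβ]
        exact H
      · have H : (stage f D).Tr (s D subset_rfl α.1)
            (l.map (fun y => a D subset_rfl y.1)) (s D subset_rfl β.1) :=
          stage_tr List.map_map (Or.inr ⟨ht, h⟩)
        exact tr_map_map φ H
    · rfl
    · exact hom_ext es ea
  · intro Z d d' h₁ _
    exact hom_ext (fun y => congrFun (congrArg st h₁) (s D subset_rfl (Subtype.val y)))
      (fun y => congrFun (congrArg ac h₁) (a D subset_rfl (Subtype.val y)))

lemma pushouts_stageMap (hD : D ⊆ D') (k : Cell f) (hD' : ∀ c, c ∈ D' ↔ c = k ∨ c ∈ D)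
    (hk : k ∉ D) (hc : ∀ t, Sum.inr t ∈ D → ∀ c, Sum.inl c ∈ D)
    (hc' : ∀ t, Sum.inr t ∈ D' → ∀ c, Sum.inl c ∈ D') :
    (generating Lab).pushouts (stageMap hD) := by
  obtain (⟨s, hs⟩ | ⟨a, ha⟩) | ⟨⟨α, l, β⟩, h⟩ := k
  · exact pushouts_stageMap_state hD s hs hD' hk hc
  · exact pushouts_stageMap_action hD a ha hD' hk hc
  · exact pushouts_stageMap_transition hD α l β h hD' (fun c => by
      simpa using (hD' _).1 (hc' _ ((hD' _).2 (Or.inl rfl)) c))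

end Pushout

/-! ### Increasing unions of cells give colimits of stages. -/

section Colimit

open Limits

variable {X Y : WTS Lab} {f : X ⟶ Y} {J : Type u} [LinearOrder J] [Nonempty J]
  {D : J → Set (Cell f)} (hD : Monotone D) {E : Set (Cell f)} (hE : ∀ j, D j ⊆ E)

/-- The cocone of stages given by a family of subsets. -/
def stageCocone : Cocone (hD.functor ⋙ stageFunctor f) where
  pt := stage f E
  ι := { app j := stageMap (hE j) }

lemma nonempty_isColimit_stageCocone (hDE : ∀ c ∈ E, ∃ j, c ∈ D j)
    (hc : ∀ j t, Sum.inr t ∈ D j → ∀ c, Sum.inl c ∈ D j) :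
    Nonempty (IsColimit (stageCocone hD hE)) := by
  have hs (s : StageState f E) : ∃ j, ∀ h, Sum.inl (Sum.inl ⟨s.1, h⟩) ∈ D j := by
    by_cases h : s.1 ∈ Set.range (st f)
    · exact ⟨Classical.arbitrary J, fun h' => (h' h).elim⟩
    · exact (hDE _ (s.2 h)).imp (fun j hj _ => hj)
  have ha (a : StageAction f E) : ∃ j, ∀ h, Sum.inl (Sum.inr ⟨a.1, h⟩) ∈ D j := by
    by_cases h : a.1 ∈ Set.range (ac f)
    · exact ⟨Classical.arbitrary J, fun h' => (h' h).elim⟩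
    · exact (hDE _ (a.2 h)).imp (fun j hj _ => hj)
  choose js hjs using hs
  choose ja hja using ha
  have main (c : Cocone (hD.functor ⋙ stageFunctor f)) :
      ∃ d : stage f E ⟶ c.pt, ∀ j, stageMap (hE j) ≫ d = c.ι.app j := by
    let leg (j : J) : stage f (D j) ⟶ c.pt := c.ι.app j
    have w {i j : J} (h : i ≤ j) : stageMap (hD h) ≫ leg j = leg i := c.w (homOfLE h)
    -- The value on a state is independent of the stage chosen, since the indices are linearly
    -- ordered.
    have hs' (s : StageState f E) (i j : J) (hi hj) :
        st (leg i) (⟨s.1, hi⟩ : StageState f (D i)) =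
          st (leg j) (⟨s.1, hj⟩ : StageState f (D j)) := by
      obtain h | h := le_total i j
      · rw [← w h]
        rfl
      · rw [← w h]
        rfl
    have ha' (a : StageAction f E) (i j : J) (hi hj) :
        ac (leg i) (⟨a.1, hi⟩ : StageAction f (D i)) =
          ac (leg j) (⟨a.1, hj⟩ : StageAction f (D j)) := by
      obtain h | h := le_total i j
      · rw [← w h]
        rfl
      · rw [← w h]
        rfl
    let j₀ : J := Classical.arbitrary J
    refine ⟨stageDesc (toStage f (D j₀) ≫ leg j₀)
      (fun s => st (leg (js s)) (⟨s.1, hjs s⟩ : StageState f _))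
      (fun a => ac (leg (ja a)) (⟨a.1, hja a⟩ : StageAction f _))
      (fun a => label_ac (leg _) _) (fun s => hs' _ _ _ _ _) (fun a => ha' _ _ _ _ _) ?_,
      fun j => hom_ext (fun s => hs' _ _ _ _ _) (fun a => ha' _ _ _ _ _)⟩
    intro α l β ht h
    obtain ⟨j, hj⟩ := hDE _ h
    -- By `hc`, a stage containing a transition cell contains all states and actions, so the whole
    -- tuple lives there.
    have H : (stage f (D j)).Tr (⟨α.1, fun _ => hc j _ hj _⟩ : StageState f (D j))
        (l.map (fun a => (⟨a.1, fun _ => hc j _ hj _⟩ : StageAction f (D j))))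
        (⟨β.1, fun _ => hc j _ hj _⟩ : StageState f (D j)) :=
      stage_tr List.map_map (Or.inr ⟨ht, hj⟩)
    have e := List.map_congr_left (l := l) (fun a _ =>
      ha' a j (ja a) (fun _ => hc j _ hj _) (hja a))
    rw [hs' α (js α) j _ (fun _ => hc j _ hj _), hs' β (js β) j _ (fun _ => hc j _ hj _), ← e]
    exact tr_map_map (leg j) H
  exact ⟨{
    desc c := (main c).choose
    fac c := (main c).choose_spec
    uniq c m hm := hom_ext
      (fun s => congrFun (congrArg st ((hm (js s)).trans ((main c).choose_spec (js s)).symm))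
        (⟨s.1, hjs s⟩ : StageState f _))
      (fun a => congrFun (congrArg ac ((hm (ja a)).trans ((main c).choose_spec (ja a)).symm))
        (⟨a.1, hja a⟩ : StageAction f _)) }⟩

end Colimit

/-! ### Assembling the transfinite composition. -/

section Transfinite

open Limits

variable {X Y : WTS Lab} (f : X ⟶ Y) [LinearOrder (Cell f)]

/-- The cells which are smaller than `j`. -/
def cellsBelow (j : WithTop (Cell f)) : Set (Cell f) := {c | (c : WithTop (Cell f)) < j}

lemma cellsBelow_monotone : Monotone (cellsBelow f) :=
  fun _ _ h _ hc => lt_of_lt_of_le hc h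

variable [WellFoundedLT (Cell f)]

lemma cell_of_wellFounded (hs : Function.Injective (st f)) (ha : Function.Injective (ac f))
    (hc : ∀ c t, (Sum.inl c : Cell f) < Sum.inr t) : cell (generating Lab) f := by
  -- Only cells strictly below an index are attached, so `⊤` is added as the index at which all are
  -- present.
  let : OrderBot (WithTop (Cell f)) := WellFoundedLT.toOrderBot _
  let : SuccOrder (WithTop (Cell f)) := SuccOrder.ofLinearWellFoundedLT _
  let F : WithTop (Cell f) ⥤ WTS Lab := (cellsBelow_monotone f).functor ⋙ stageFunctor f
  have hc' (j t) (h : Sum.inr t ∈ cellsBelow f j) (c) : Sum.inl c ∈ cellsBelow f j :=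
    lt_trans (WithTop.coe_lt_coe.2 (hc c t)) h
  have : F.IsWellOrderContinuous := by
    refine ⟨fun m hm => ?_⟩
    have : Nonempty (Set.Iio m) := ⟨⟨⊥, hm.bot_lt⟩⟩
    exact nonempty_isColimit_stageCocone (D := fun i : Set.Iio m => cellsBelow f i.1)
      (fun _ _ h => cellsBelow_monotone f h) (fun i => cellsBelow_monotone f i.2.le)
      (fun c h => ⟨⟨Order.succ (c : WithTop (Cell f)), hm.succ_lt h⟩,
        show (c : WithTop (Cell f)) < Order.succ (c : WithTop (Cell f)) from
          Order.lt_succ_of_not_isMax (fun h' => h'.not_lt h)⟩) (fun i => hc' i.1)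
  have hbot : IsIso (toStage f (cellsBelow f ⊥)) := by
    have : cellsBelow f ⊥ = ∅ := Set.eq_empty_of_forall_notMem
      (fun c h => not_lt_bot (a := (c : WithTop (Cell f))) h)
    rw [this]
    exact isIso_toStage_empty hs ha
  have htop : IsIso (fromStage f (cellsBelow f ⊤)) := by
    have : cellsBelow f ⊤ = Set.univ := Set.eq_univ_of_forall WithTop.coe_lt_top
    rw [this]
    exact isIso_fromStage_univ
  refine MorphismProperty.transfiniteCompositionsOfShape_le_transfiniteCompositions _
    (WithTop (Cell f)) _ ⟨{
      F := F
      isoBot := (asIso (toStage f (cellsBelow f ⊥))).symm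
      incl := { app j := fromStage f (cellsBelow f j) }
      -- The colimit is the value at the terminal index `⊤`, which is isomorphic to `Y`.
      isColimit := IsColimit.ofIsoColimit (colimitOfDiagramTerminal isTerminalTop F)
        (Cocone.ext (@asIso _ _ _ _ (fromStage f (cellsBelow f ⊤)) htop))
      fac := rfl
      map_mem := fun j hj => ?_ }⟩
  obtain ⟨k, rfl⟩ : ∃ k : Cell f, k = j := WithTop.ne_top_iff_exists.1 
    (fun h => hj (by rw [h]; exact isMax_top))
  refine pushouts_stageMap (f := f) _ k (fun c => ?_) (lt_irrefl (k : WithTop (Cell f)))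
    (hc' _) (hc' _)
  change (c : WithTop (Cell f)) < Order.succ (k : WithTop (Cell f)) ↔
    c = k ∨ (c : WithTop (Cell f)) < k
  rw [Order.lt_succ_iff_of_not_isMax hj, le_iff_eq_or_lt, WithTop.coe_inj]

end Transfinite

lemma monomorphisms_le_cell :
    MorphismProperty.monomorphisms (WTS Lab) ≤ cell (generating Lab) := by
  intro X Y f (_ : Mono f)
  classical
  -- The lexicographic sum puts all states and actions before all transitions.
  let r : Cell f → Cell f → Prop := Sum.Lex WellOrderingRel WellOrderingRel
  have hr : IsWellOrder (Cell f) r := inferInstanceAs (IsWellOrder _ (Sum.Lex _ _))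
  let : LinearOrder (Cell f) := IsWellOrder.linearOrder r
  have : WellFoundedLT (Cell f) := ⟨hr.wf⟩
  exact cell_of_wellFounded f (st_injective_of_mono f) (ac_injective_of_mono f)
    (fun c t => (Sum.Lex.sep c t : r _ _))

end WTS

theorem proposition2p4 (Lab : Type u) [Nonempty Lab] :
    cell (WTS.generating Lab) = cof (WTS.generating Lab) ∧
      cell (WTS.generating Lab) = MorphismProperty.monomorphisms (WTS Lab) := by
  have h : cell (WTS.generating Lab) ≤ cof (WTS.generating Lab) := by
    refine (MorphismProperty.transfiniteCompositions_le_llp_rlp _).trans ?_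
    rw [MorphismProperty.rlp_pushouts]
    exact le_rfl
  have h' := WTS.cof_le_monomorphisms (Lab := Lab)
  have h'' := WTS.monomorphisms_le_cell (Lab := Lab)
  exact ⟨le_antisymm h (h'.trans h''), le_antisymm (h.trans h') h''⟩
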